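/- Assume GCH, and let $\kappa$ be an infinite regular cardinal. Call a linear order $Q$ $\kappa$-saturated if for all (possibly empty) $S,T\subseteq Q$ of size $<\kappa$ with $s<t$ for all $s\in S$, $t\in T$, there is $x\in Q$ with $s<x<t$ for all $s\in S$, $t\in T$. Let $\mathbb{Q}(\kappa)$ denote a $\kappa$-saturated linear order of size $\kappa$ without endpoints, and let $\bar{\mathbb{Q}}(\kappa)$ be its completion under sequences of length $<\kappa$, that is, the suborder of the Dedekind completion of $\mathbb{Q}(\kappa)$ consisting of the points of $\mathbb{Q}(\kappa)$ and of the suprema of bounded increasing sequences and the infima of bounded decreasing sequences, of nonzero length $<\kappa$, of points of $\mathbb{Q}(\kappa)$. A LOTS is a linear order with its open interval topology. A LOTS $L$ is $\kappa$-entwined if $|L|=\kappa$ and every $x\in L$ that is a two-sided limit point (there are points of $L$ below and above $x$, and $\sup\{y\in L:y<x\}=x=\inf\{y\in L:y>x\}$) has cofinality and coinitiality both equal to $\kappa$; here the cofinality of $x$ is the least cardinality of a set of points below $x$ with supremum $x$, and the coinitiality of $x$ is the least cardinality of a set of points above $x$ with infimum $x$. Then an order $\mathbb{Q}(\kappa)$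 exists, and for every such order $\bar{\mathbb{Q}}(\kappa)$ has size $\kappa$ and is universal for $\kappa$-entwined LOTS: for every $\kappa$-entwined LOTS $L$ there is an injective order-preserving map $L\to\bar{\mathbb{Q}}(\kappa)$ that is continuous for the open interval topologies. -/

import Mathlib

open scoped Cardinal

universe u

/-- The generalised continuum hypothesis: `2 ^ c = c⁺` for every infinite cardinal `c`. -/
def GCH : Prop := ∀ c : Cardinal.{u}, ℵ₀ ≤ c → (2 : Cardinal.{u}) ^ c = Order.succ c

/-- `κ`-saturation: whenever `S < T` are subsets of size `< κ` (possibly empty), some point lies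
strictly between them. -/
def IsSaturatedOrder (κ : Cardinal.{u}) (Q : Type u) [LinearOrder Q] : Prop :=
  ∀ S T : Set Q, #S < κ → #T < κ → (∀ s ∈ S, ∀ t ∈ T, s < t) →
    ∃ x : Q, (∀ s ∈ S, s < x) ∧ (∀ t ∈ T, x < t)

/-- `Q` is (a copy of) the order `ℚ(κ)`: the `κ`-saturated linear order of size `κ` without
endpoints. -/
structure IsRationalOrder (κ : Cardinal.{u}) (Q : Type u) [LinearOrder Q] : Prop where
  card_eq : #Q = κ
  saturated : IsSaturatedOrder κ Q
  noMin : NoMinOrder Q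
  noMax : NoMaxOrder Q

/-- The points of the Dedekind completion of `Q` that are points of `Q`, or the supremum or the
infimum of a nonempty bounded subset of `Q` of size `< κ`. A supremum of a set of size `< κ` is the
same as a supremum of an increasing sequence of length `< κ`, and dually. -/
def IsSeqCut (κ : Cardinal.{u}) {Q : Type u} [LinearOrder Q] (c : DedekindCut Q) : Prop :=
  (∃ q : Q, c = DedekindCut.principal q) ∨
  (∃ s : Set Q, s.Nonempty ∧ BddAbove s ∧ #s < κ ∧ c = sSup (DedekindCut.principal '' s)) ∨
  (∃ s : Set Q, s.Nonempty ∧ BddBelow s ∧ #s < κ ∧ c = sInf (DedekindCut.principal '' s))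

/-- The completion of `Q` under sequences of length `< κ`, with the order inherited from the
Dedekind completion. -/
abbrev SeqCompletion (κ : Cardinal.{u}) (Q : Type u) [LinearOrder Q] : Type u :=
  {c : DedekindCut Q // IsSeqCut κ c}

/-- A LOTS embedding of `A` into `B`: an injective order-preserving map that is continuous for the
open interval topologies. -/
def LOTSEmbeds (A B : Type u) [LinearOrder A] [LinearOrder B] : Prop :=
  ∃ f : A → B, StrictMono f ∧
    @Continuous A B (Preorder.topology A) (Preorder.topology B) f

/-- `L` has size `κ`, and every two-sided limit point `x` of `L` (a point with
`sup l(x) = inf r(x) = x`, where `l(x)` and `r(x)`, the sets of points below and above `x`, are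
nonempty) has cofinality and coinitiality `κ`. For such `x`, a subset of `l(x)` is cofinal in `l(x)`
exactly when its supremum is `x`, and dually. -/
structure IsEntwined (κ : Cardinal.{u}) (L : Type u) [LinearOrder L] : Prop where
  card_eq : #L = κ
  limit : ∀ x : L, (Set.Iio x).Nonempty → (Set.Ioi x).Nonempty →
    IsLUB (Set.Iio x) x → IsGLB (Set.Ioi x) x →
      Order.cof (Set.Iio x) = κ ∧ Order.cof (Set.Ioi x)ᵒᵈ = κ

/-- `SeqCompletion κ Q` is complete for sequences of length `< κ`, upwards. -/
theorem SeqCompletion.exists_isLUB {κ : Cardinal.{u}} {Q : Type u} [LinearOrder Q]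
    (S : Set (SeqCompletion κ Q)) (hne : S.Nonempty) (hb : BddAbove S) (hc : #S < κ) :
    ∃ x, IsLUB S x := by
  by_cases hm : ∃ m ∈ S, ∀ s ∈ S, s ≤ m
  · obtain ⟨m, hm, h⟩ := hm
    exact ⟨m, h, fun b hb => hb hm⟩
  push Not at hm
  have key : ∀ s : S, ∃ q : Q, s.1.1 ≤ DedekindCut.principal q ∧
      ∃ t ∈ S, DedekindCut.principal q < t.1 := by
    intro s
    obtain ⟨t, ht, hst⟩ := hm s.1 s.2
    obtain ⟨q, h1, h2⟩ := DedekindCut.lt_iff_exists'.1 (show s.1.1 < t.1 from hst)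
    exact ⟨q, h1, t, ht, h2⟩
  choose q hq t ht hqt using key
  obtain ⟨b, hb⟩ := hb
  have hbd : ∃ r : Q, b.1 ≤ DedekindCut.principal r := by
    rcases b.2 with ⟨r, hr⟩ | ⟨s, -, ⟨r, hr⟩, -, hs⟩ | ⟨s, ⟨r, hr⟩, -, -, hs⟩
    · exact ⟨r, hr.le⟩
    · refine ⟨r, hs ▸ sSup_le ?_⟩
      rintro _ ⟨y, hy, rfl⟩
      exact DedekindCut.principal_le_principal.2 (hr hy)
    · exact ⟨r, hs ▸ sInf_le ⟨r, hr, rfl⟩⟩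
  obtain ⟨r, hr⟩ := hbd
  have : Nonempty S := hne.to_subtype
  refine ⟨⟨sSup (DedekindCut.principal '' Set.range q), Or.inr (Or.inl ⟨Set.range q,
    Set.range_nonempty q, ⟨r, ?_⟩, Cardinal.mk_range_le.trans_lt hc, rfl⟩)⟩, ?_, ?_⟩
  · rintro _ ⟨s, rfl⟩
    exact DedekindCut.principal_le_principal.1
      (((hqt s).le.trans (show (t s).1 ≤ b.1 from hb (ht s))).trans hr)
  · intro s hs
    exact (hq ⟨s, hs⟩).trans (le_sSup ⟨_, ⟨⟨s, hs⟩, rfl⟩, rfl⟩)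
  · intro c hc
    refine sSup_le (α := DedekindCut Q) ?_
    rintro _ ⟨_, ⟨s, rfl⟩, rfl⟩
    exact (hqt s).le.trans (show (t s).1 ≤ c.1 from hc (ht s))

/-- `SeqCompletion κ Q` is complete for sequences of length `< κ`, downwards. -/
theorem SeqCompletion.exists_isGLB {κ : Cardinal.{u}} {Q : Type u} [LinearOrder Q]
    (S : Set (SeqCompletion κ Q)) (hne : S.Nonempty) (hb : BddBelow S) (hc : #S < κ) :
    ∃ x, IsGLB S x := by
  by_cases hm : ∃ m ∈ S, ∀ s ∈ S, m ≤ s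
  · obtain ⟨m, hm, h⟩ := hm
    exact ⟨m, h, fun b hb => hb hm⟩
  push Not at hm
  have key : ∀ s : S, ∃ q : Q, DedekindCut.principal q ≤ s.1.1 ∧
      ∃ t ∈ S, t.1 < DedekindCut.principal q := by
    intro s
    obtain ⟨t, ht, hst⟩ := hm s.1 s.2
    obtain ⟨q, h1, h2⟩ := DedekindCut.lt_iff_exists.1 (show t.1 < s.1.1 from hst)
    exact ⟨q, h2, t, ht, h1⟩
  choose q hq t ht hqt using key
  obtain ⟨b, hb⟩ := hb
  have hbd : ∃ r : Q, DedekindCut.principal r ≤ b.1 := by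
    rcases b.2 with ⟨r, hr⟩ | ⟨s, ⟨r, hr⟩, -, -, hs⟩ | ⟨s, -, ⟨r, hr⟩, -, hs⟩
    · exact ⟨r, hr.ge⟩
    · exact ⟨r, hs ▸ le_sSup ⟨r, hr, rfl⟩⟩
    · refine ⟨r, hs ▸ le_sInf ?_⟩
      rintro _ ⟨y, hy, rfl⟩
      exact DedekindCut.principal_le_principal.2 (hr hy)
  obtain ⟨r, hr⟩ := hbd
  have : Nonempty S := hne.to_subtype
  refine ⟨⟨sInf (DedekindCut.principal '' Set.range q), Or.inr (Or.inr ⟨Set.range q,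
    Set.range_nonempty q, ⟨r, ?_⟩, Cardinal.mk_range_le.trans_lt hc, rfl⟩)⟩, ?_, ?_⟩
  · rintro _ ⟨s, rfl⟩
    exact DedekindCut.principal_le_principal.1
      (hr.trans ((show b.1 ≤ (t s).1 from hb (ht s)).trans (hqt s).le))
  · intro s hs
    have h : sInf (DedekindCut.principal '' Set.range q) ≤ DedekindCut.principal (q ⟨s, hs⟩) :=
      sInf_le ⟨_, ⟨⟨s, hs⟩, rfl⟩, rfl⟩
    exact h.trans (hq ⟨s, hs⟩)
  · intro c hc
    refine le_sInf (α := DedekindCut Q) ?_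
    rintro _ ⟨_, ⟨s, rfl⟩, rfl⟩
    exact (show c.1 ≤ (t s).1 from hc (ht s)).trans (hqt s).le

/-!
Two constructions of length `κ` carry the proof.

A `κ`-saturated order of size `κ` is given by Hausdorff's lexicographic order on the functions
`κ → {0, 1, 2}` that differ from `1` at fewer than `κ` places. All functions form a complete order,
and a supremum in it is turned into a strictly separating function of small support by cutting it
off above the supports involved (`HausdorffOrder.isSaturatedOrder`). GCH enters only through
`GCH.mk_small_sets_le`, that a set of size `κ` has at most `κ` subsets of size `< κ`; this bounds
the size both of Hausdorff's order and of the completion.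

For universality, let `L` be `κ`-entwined and `Q` saturated of size `κ`. An embedding `g : L → Q`
is built by transfinite recursion on its graph, with the extra requirement that `g` be continuous at
`x` from each side on which `x` has character at least `κ`. This is possible because a partial
embedding of size `< κ` does not reach `x` from such a side, so there is always room for one more
point whose value is as close to `g x` as desired (`exists_strictMono_approaching`). No continuity
is asked of `g` at a point of character `< κ`. There the map into the completion takes
instead the supremum of `g` to the left of `x`, or the infimum to the right of `x`, which exists as
a point of the completion since it comes from a set of size `< κ`. Entwinedness is exactly what makes
the choice of side unambiguous: at a two-sided limit point both characters are `κ`, so `g x` is kept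
(`IsEntwined.exists_isLimitValue`). The values so chosen are strictly increasing
(`IsLimitValue.lt`) and are approached from every side from which a point is a limit, and this gives
continuity for the order topologies.
-/

open Set Cardinal

/-! ### Cardinal arithmetic -/

theorem GCH.two_power_le (gch : GCH.{u}) {κ μ : Cardinal.{u}} (hκ : ℵ₀ ≤ κ) (h : μ < κ) :
    2 ^ μ ≤ κ := by
  rcases lt_or_ge μ ℵ₀ with h0 | h0
  · exact (power_lt_aleph0 (natCast_lt_aleph0 (n := 2)) h0).le.trans hκ
  · exact (gch μ h0).trans_le (Order.succ_le_of_lt h)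

/-- The order type of a regular `κ`: a well-order of size `κ` whose initial segments are small and
whose small subsets are strictly bounded. -/
theorem Cardinal.IsRegular.exists_wellOrder {κ : Cardinal.{u}} (hκ : κ.IsRegular) :
    ∃ (I : Type u) (_ : LinearOrder I) (_ : WellFoundedLT I), #I = κ ∧
      (∀ i : I, #(Iio i) < κ) ∧ ∀ S : Set I, #S < κ → ∃ i, ∀ s ∈ S, s < i := by
  refine ⟨κ.ord.ToType, inferInstance, inferInstance, ?_, fun i => ?_, fun S hS => ?_⟩
  · simp
  · have := mk_Iio_lt i (by simp)
    simpa using this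
  · by_contra! h
    refine hS.not_ge ?_
    have := Order.cof_le (α := κ.ord.ToType) (s := S) h
    rwa [Ordinal.cof_toType, hκ.cof_ord] at this

/-- Under GCH there are `κ ^< κ = κ` subsets of size `< κ`. -/
theorem GCH.mk_small_sets_le (gch : GCH.{u}) {κ : Cardinal.{u}} (hκ : κ.IsRegular) {α : Type u}
    (hα : #α ≤ κ) : #{S : Set α // #S < κ} ≤ κ := by
  obtain ⟨I, _, _, hI, hsmall, hbd⟩ := hκ.exists_wellOrder
  obtain ⟨e⟩ : Nonempty (α ↪ I) := by rw [← Cardinal.le_def, hI]; exact hα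
  -- A small subset of `I` is bounded, so it is a subset of an initial segment.
  let F : (Σ i : I, Set (Iio i)) → Set α := fun p => e ⁻¹' (Subtype.val '' p.2)
  have hF : {S : Set α | #S < κ} ⊆ range F := by
    intro S hS
    obtain ⟨i, hi⟩ := hbd (e '' S) (mk_image_le.trans_lt hS)
    refine ⟨⟨i, {j | ∃ s ∈ S, e s = j}⟩, ?_⟩
    ext x
    constructor
    · rintro ⟨_, ⟨s, hs, h⟩, h'⟩
      rwa [← e.injective (h.trans h')]
    · exact fun hx => ⟨⟨e x, hi _ ⟨x, hx, rfl⟩⟩, ⟨x, hx, rfl⟩, rfl⟩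
  refine (mk_le_mk_of_subset hF).trans (mk_range_le.trans ?_)
  rw [mk_sigma]
  refine (sum_le_sum _ (fun _ => κ) fun i => ?_).trans ?_
  · rw [mk_set]
    exact gch.two_power_le hκ.aleph0_le (hsmall i)
  · rw [sum_const', hI, mul_eq_self hκ.aleph0_le]

/-! ### The saturated order of size `κ` -/

theorem exists_isLUB_lex {I : Type u} [LinearOrder I] [WellFoundedLT I]
    (S : Set (Lex (I → Fin 3))) : ∃ c, IsLUB S c :=
  ⟨_, isLUB_sSup S⟩

theorem IsSaturatedOrder.le_mk {κ : Cardinal.{u}} {Q : Type u} [LinearOrder Q] (h0 : 0 < κ)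
    (h : IsSaturatedOrder κ Q) : κ ≤ #Q := by
  by_contra! hlt
  obtain ⟨x, hx, -⟩ := h univ ∅ (by rwa [mk_univ]) (by simpa using h0) (by simp)
  exact lt_irrefl x (hx x trivial)

/-- The lexicographically ordered functions `I → {0, 1, 2}` whose value differs from `1` at fewer
than `κ` places. -/
abbrev HausdorffOrder (κ : Cardinal.{u}) (I : Type u) : Type u :=
  {f : Lex (I → Fin 3) // #{i | f i ≠ 1} < κ}

/-- The supports of the functions in `S ∪ T` lie below a common `i`. The supremum `c` of `S` among
all functions separates `S` from `T` weakly; cutting `c` off at `i` and choosing the value at `i` to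
be `2` or `0` separates them strictly, because `c` cannot agree below `i` both with a member of `S`
and with a member of `T`. -/
theorem HausdorffOrder.isSaturatedOrder {κ : Cardinal.{u}} (hκ : κ.IsRegular) {I : Type u}
    [LinearOrder I] [WellFoundedLT I] (hsmall : ∀ i : I, #(Iio i) < κ)
    (hbd : ∀ S : Set I, #S < κ → ∃ i, ∀ s ∈ S, s < i) :
    IsSaturatedOrder κ (HausdorffOrder κ I) := by
  classical
  intro S T hS hT hST
  obtain ⟨i, hi⟩ : ∃ i : I, ∀ f ∈ S ∪ T, ∀ j, i ≤ j → f.1 j = 1 := by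
    obtain ⟨i, hi⟩ := hbd (⋃ f ∈ S ∪ T, {j | f.1 j ≠ 1})
      ((card_biUnion_lt_iff_forall_of_isRegular hκ
        ((mk_union_le S T).trans_lt (add_lt_of_lt hκ.aleph0_le hS hT))).2 fun f _ => f.2)
    refine ⟨i, fun f hf j hj => ?_⟩
    by_contra h
    exact (hi j (mem_biUnion hf h)).not_ge hj
  obtain ⟨c, hc⟩ := exists_isLUB_lex (Subtype.val '' S)
  have hcS : ∀ s ∈ S, s.1 ≤ c := fun s hs => hc.1 ⟨s, hs, rfl⟩
  have hcT : ∀ t ∈ T, c ≤ t.1 := fun t ht =>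
    hc.2 (by rintro _ ⟨s, hs, rfl⟩; exact (hST s hs t ht).le)
  let v : Fin 3 := if ∃ s ∈ S, ∀ j < i, s.1 j = c j then 2 else 0
  let x : Lex (I → Fin 3) := toLex fun j => if j < i then c j else if j = i then v else 1
  have hxlt : ∀ j < i, x j = c j := fun j hj => if_pos hj
  have hxi : x i = v := by simp [x]
  have hx : #{j | x j ≠ 1} < κ := by
    refine (mk_le_mk_of_subset (t := insert i (Iio i)) fun j hj => ?_).trans_lt
      (mk_insert_le.trans_lt (add_one_lt_of_lt hκ.aleph0_le (hsmall i)))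
    by_contra h
    simp only [mem_insert_iff, mem_Iio, not_or] at h
    exact hj (by simp [x, h])
  refine ⟨⟨x, hx⟩, fun s hs => ?_, fun t ht => ?_⟩
  · by_cases h : ∀ j < i, s.1 j = c j
    · refine ⟨i, fun j hj => (h j hj).trans (hxlt j hj).symm, ?_⟩
      change s.1 i < x i
      rw [hi s (Or.inl hs) i le_rfl, hxi, show v = 2 from if_pos ⟨s, hs, h⟩]
      decide
    · obtain ⟨k, hk, hlt⟩ := (hcS s hs).lt_of_ne fun e => h fun j _ => by rw [e]
      have hki : k < i := by
        by_contra! hik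
        exact h fun j hj => hk j (hj.trans_le hik)
      exact ⟨k, fun j hj => (hk j hj).trans (hxlt j (hj.trans hki)).symm,
        hlt.trans_eq (hxlt k hki).symm⟩
  · by_cases h : ∀ j < i, t.1 j = c j
    · have hv : v = 0 := if_neg <| by
        rintro ⟨s, hs, h'⟩
        refine (hST s hs t ht).ne (Subtype.ext (funext fun j => ?_))
        rcases lt_or_ge j i with hj | hj
        · exact (h' j hj).trans (h j hj).symm
        · exact (hi s (Or.inl hs) j hj).trans (hi t (Or.inr ht) j hj).symm
      refine ⟨i, fun j hj => (hxlt j hj).trans (h j hj).symm, ?_⟩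
      change x i < t.1 i
      rw [hi t (Or.inr ht) i le_rfl, hxi, hv]
      decide
    · obtain ⟨k, hk, hlt⟩ := (hcT t ht).lt_of_ne fun e => h fun j _ => by rw [e]
      have hki : k < i := by
        by_contra! hik
        exact h fun j hj => (hk j (hj.trans_le hik)).symm
      exact ⟨k, fun j hj => (hxlt j (hj.trans hki)).trans (hk j hj),
        (hxlt k hki).trans_lt hlt⟩

theorem GCH.exists_isRationalOrder (gch : GCH.{u}) {κ : Cardinal.{u}} (hκ : κ.IsRegular) :
    ∃ (Q : Type u) (_ : LinearOrder Q), IsRationalOrder κ Q := by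
  obtain ⟨I, _, _, hI, hsmall, hbd⟩ := hκ.exists_wellOrder
  have hsat : IsSaturatedOrder κ (HausdorffOrder κ I) :=
    HausdorffOrder.isSaturatedOrder hκ hsmall hbd
  have hone : (1 : Cardinal.{u}) < κ := one_lt_aleph0.trans_le hκ.aleph0_le
  refine ⟨HausdorffOrder κ I, inferInstance, ⟨?_, hsat, ⟨fun q => ?_⟩, ⟨fun q => ?_⟩⟩⟩
  · refine le_antisymm ?_ (hsat.le_mk hκ.pos)
    -- A function is determined by the sets where it takes the values `0` and `2`.
    let F : HausdorffOrder κ I → {S : Set I // #S < κ} × {S : Set I // #S < κ} := fun f =>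
      (⟨{i | f.1 i = 0}, (mk_le_mk_of_subset fun i (hi : f.1 i = 0) => by simp [hi]).trans_lt f.2⟩,
       ⟨{i | f.1 i = 2}, (mk_le_mk_of_subset fun i (hi : f.1 i = 2) => by simp [hi]).trans_lt f.2⟩)
    have hF : Function.Injective F := by
      intro f g h
      simp only [F, Prod.mk.injEq, Subtype.mk.injEq, Set.ext_iff, mem_ofPred_eq] at h
      refine Subtype.ext (funext fun i => ?_)
      have h0 := h.1 i
      have h2 := h.2 i
      generalize f.1 i = a at h0 h2
      generalize g.1 i = b at h0 h2
      revert a b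
      decide
    refine (mk_le_of_injective hF).trans ?_
    rw [mk_prod, lift_id]
    have := gch.mk_small_sets_le hκ hI.le
    exact mul_le_of_le hκ.aleph0_le this this
  · obtain ⟨x, -, hx⟩ := hsat ∅ {q} (by simpa using hκ.pos) (by simpa using hone) (by simp)
    exact ⟨x, hx q rfl⟩
  · obtain ⟨x, hx, -⟩ := hsat {q} ∅ (by simpa using hone) (by simpa using hκ.pos) (by simp)
    exact ⟨x, hx q rfl⟩

/-! ### The size of the completion -/

theorem GCH.mk_seqCompletion (gch : GCH.{u}) {κ : Cardinal.{u}} (hκ : κ.IsRegular) {Q : Type u}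
    [LinearOrder Q] (hQ : #Q = κ) : #(SeqCompletion κ Q) = κ := by
  have hsub := gch.mk_small_sets_le hκ hQ.le
  refine le_antisymm ?_ ?_
  · let F : Q ⊕ {S : Set Q // #S < κ} ⊕ {S : Set Q // #S < κ} → DedekindCut Q :=
      Sum.elim DedekindCut.principal (Sum.elim (fun S => sSup (DedekindCut.principal '' S.1))
        (fun S => sInf (DedekindCut.principal '' S.1)))
    have hF : {c : DedekindCut Q | IsSeqCut κ c} ⊆ range F := by
      rintro c (⟨q, rfl⟩ | ⟨s, -, -, hs, rfl⟩ | ⟨s, -, -, hs, rfl⟩)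
      · exact ⟨Sum.inl q, rfl⟩
      · exact ⟨Sum.inr (Sum.inl ⟨s, hs⟩), rfl⟩
      · exact ⟨Sum.inr (Sum.inr ⟨s, hs⟩), rfl⟩
    refine (mk_le_mk_of_subset hF).trans (mk_range_le.trans ?_)
    rw [mk_sum, mk_sum]
    simp only [lift_id]
    exact add_le_of_le hκ.aleph0_le hQ.le (add_le_of_le hκ.aleph0_le hsub hsub)
  · refine hQ.ge.trans ?_
    exact mk_le_of_injective (f := fun q => (⟨DedekindCut.principal q, Or.inl ⟨q, rfl⟩⟩ :
      SeqCompletion κ Q)) fun a b h => DedekindCut.principal_inj.1 (congrArg Subtype.val h)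

/-! ### Transfinite recursion by small extensions -/

/-- Transfinite recursion of regular length `κ`. If `P` is closed under unions of chains and a small
set with `P` can always be enlarged to a small set with `P` fulfilling a given one of at most `κ`
many monotone tasks `R t`, then some set with `P` fulfils all the tasks. -/
theorem exists_of_small_extensions {κ : Cardinal.{u}} (hκ : κ.IsRegular) {α T : Type u}
    (hT : #T ≤ κ) {P : Set α → Prop} {R : T → Set α → Prop}
    (hmono : ∀ t G G', G ⊆ G' → R t G → R t G')
    (hchain : ∀ C : Set (Set α), IsChain (· ⊆ ·) C → (∀ G ∈ C, P G) → P (⋃₀ C))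
    (hext : ∀ t G, P G → #G < κ → ∃ G', G ⊆ G' ∧ P G' ∧ #G' < κ ∧ R t G') :
    ∃ G, P G ∧ ∀ t, R t G := by
  classical
  obtain ⟨I, _, _, hI, hsmall, -⟩ := hκ.exists_wellOrder
  rcases isEmpty_or_nonempty T with hTe | hTne
  · exact ⟨⋃₀ ∅, hchain ∅ IsChain.empty (by simp), fun t => hTe.elim t⟩
  obtain ⟨e⟩ : Nonempty (T ↪ I) := by rw [← Cardinal.le_def, hI]; exact hT
  let τ : I → T := Function.invFun e
  choose! E hE using hext
  -- Outside the intended case `step i` is the identity, so that `step i G` always contains `G`.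
  let step : I → Set α → Set α := fun i G => if P G ∧ #G < κ then E (τ i) G else G
  have hstep : ∀ i G, G ⊆ step i G := by
    intro i G
    by_cases h : P G ∧ #G < κ
    · simpa only [step, if_pos h] using (hE (τ i) G h.1 h.2).1
    · simp only [step, if_neg h, subset_rfl]
  let G : I → Set α := wellFounded_lt.fix (r := ((· < ·) : I → I → Prop)) fun i rec =>
    step i (⋃ j : Iio i, rec j.1 j.2)
  have hG : ∀ i, G i = step i (⋃ j : Iio i, G j) := fun i => wellFounded_lt.fix_eq _ i
  have hlt : ∀ i j, i < j → G i ⊆ G j := by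
    intro i j hij
    rw [hG j]
    exact (subset_iUnion (fun k : Iio j => G k) ⟨i, hij⟩).trans (hstep _ _)
  have hle : Monotone G := fun i j hij => hij.eq_or_lt.elim (fun h => h ▸ subset_rfl) (hlt i j)
  have hun : ∀ {ι : Type u} (f : ι → I), (∀ k, P (G (f k))) → P (⋃ k, G (f k)) := by
    intro ι f h
    rw [← sUnion_range]
    refine hchain _ ?_ (by rintro _ ⟨k, rfl⟩; exact h k)
    rintro _ ⟨k, rfl⟩ _ ⟨l, rfl⟩ -
    exact (le_total (f k) (f l)).imp (fun h => hle h) (fun h => hle h)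
  have main : ∀ i, P (G i) ∧ #(G i) < κ ∧ R (τ i) (G i) := by
    intro i
    induction i using WellFoundedLT.induction with
    | ind i ih =>
    have h : P (⋃ j : Iio i, G j) ∧ #(⋃ j : Iio i, G j) < κ :=
      ⟨hun (fun j : Iio i => j.1) fun j => (ih j j.2).1,
        (card_iUnion_lt_iff_forall_of_isRegular hκ (hsmall i)).2 fun j => (ih j j.2).2.1⟩
    rw [hG i]
    simp only [step, if_pos h]
    exact (hE (τ i) _ h.1 h.2).2
  refine ⟨⋃ i, G i, hun id fun i => (main i).1, fun t => ?_⟩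
  refine hmono t (G (e t)) _ (subset_iUnion G (e t)) ?_
  have := (main (e t)).2.2
  rwa [show τ (e t) = t from Function.leftInverse_invFun e.injective t] at this

/-! ### Partial embeddings into a saturated order -/

section PartialEmbedding

variable {κ : Cardinal.{u}} {L Q : Type u} [LinearOrder L] [LinearOrder Q]

/-- `G` is the graph of an order isomorphism between a subset of `L` and a subset of `Q`. Both
single-valuedness and injectivity follow from the equivalence, by trichotomy. -/
def IsPartialEmbedding (G : Set (L × Q)) : Prop :=
  ∀ p ∈ G, ∀ q ∈ G, p.1 < q.1 ↔ p.2 < q.2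

theorem IsPartialEmbedding.sUnion {C : Set (Set (L × Q))} (hC : IsChain (· ⊆ ·) C)
    (h : ∀ G ∈ C, IsPartialEmbedding G) : IsPartialEmbedding (⋃₀ C) := by
  rintro p ⟨G, hG, hp⟩ q ⟨G', hG', hq⟩
  rcases hC.total hG hG' with hs | hs
  · exact h G' hG' p (hs hp) q hq
  · exact h G hG p hp q (hs hq)

/-- A small partial embedding into a saturated order extends to one more point `x`, with a value
above any prescribed small set `A` that lies below the values taken to the right of `x`. -/
theorem IsPartialEmbedding.exists_extension (hκ : κ.IsRegular) (hQ : IsSaturatedOrder κ Q)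
    {G : Set (L × Q)} (hG : IsPartialEmbedding G) (hc : #G < κ) {x : L} (hx : ∀ p ∈ G, p.1 ≠ x)
    {A : Set Q} (hA : #A < κ) (hAG : ∀ a ∈ A, ∀ p ∈ G, x < p.1 → a < p.2) :
    ∃ r : Q, (∀ a ∈ A, a < r) ∧ IsPartialEmbedding (insert (x, r) G) ∧
      #(insert (x, r) G : Set (L × Q)) < κ := by
  have hcard : ∀ D ⊆ G, #(Prod.snd '' D : Set Q) < κ := fun D hD =>
    mk_image_le.trans_lt ((mk_le_mk_of_subset hD).trans_lt hc)
  obtain ⟨r, hr1, hr2⟩ := hQ (A ∪ Prod.snd '' {p ∈ G | p.1 < x}) (Prod.snd '' {p ∈ G | x < p.1})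
    ((mk_union_le _ _).trans_lt (add_lt_of_lt hκ.aleph0_le hA (hcard _ (sep_subset _ _))))
    (hcard _ (sep_subset _ _)) (by
      rintro a (ha | ⟨p, ⟨hp, hpx⟩, rfl⟩) _ ⟨q, ⟨hq, hqx⟩, rfl⟩
      · exact hAG a ha q hq hqx
      · exact (hG p hp q hq).1 (hpx.trans hqx))
  have hlo : ∀ p ∈ G, p.1 < x → p.2 < r := fun p hp h => hr1 _ (Or.inr ⟨p, ⟨hp, h⟩, rfl⟩)
  have hhi : ∀ p ∈ G, x < p.1 → r < p.2 := fun p hp h => hr2 _ ⟨p, ⟨hp, h⟩, rfl⟩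
  refine ⟨r, fun a ha => hr1 a (Or.inl ha), ?_,
    mk_insert_le.trans_lt (add_one_lt_of_lt hκ.aleph0_le hc)⟩
  rintro p (rfl | hp) q (rfl | hq)
  · simp
  · rcases (hx q hq).lt_or_gt with h | h
    · exact iff_of_false h.not_gt (hlo q hq h).not_gt
    · exact iff_of_true h (hhi q hq h)
  · rcases (hx p hp).lt_or_gt with h | h
    · exact iff_of_true h (hlo p hp h)
    · exact iff_of_false h.not_gt (hhi p hp h).not_gt
  · exact hG p hp q hq

theorem exists_forall_lt_of_le_cof {x : L} (hx : κ ≤ Order.cof (Iio x)) {A : Set L}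
    (hA : #A < κ) (hAx : ∀ a ∈ A, a < x) : ∃ y < x, ∀ a ∈ A, a < y := by
  by_contra! h
  refine (hx.trans (Order.cof_le (s := ((↑) : Iio x → L) ⁻¹' A) fun y => ?_)).not_gt
    ((mk_preimage_of_injective _ _ Subtype.val_injective).trans_lt hA)
  obtain ⟨a, ha, hya⟩ := h y y.2
  exact ⟨⟨a, hAx a ha⟩, ha, hya⟩

/-- If `x` has cofinality at least `κ`, a small partial embedding defined at `x` extends to a point
left of `x` whose value exceeds a given `q` below the value at `x`. -/
theorem IsPartialEmbedding.exists_approach (hκ : κ.IsRegular) (hQ : IsSaturatedOrder κ Q)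
    {G : Set (L × Q)} (hG : IsPartialEmbedding G) (hc : #G < κ) {x : L} {r q : Q} (hx : (x, r) ∈ G)
    (hq : q < r) (hcof : κ ≤ Order.cof (Iio x)) :
    ∃ G', G ⊆ G' ∧ IsPartialEmbedding G' ∧ #G' < κ ∧ ∃ p ∈ G', p.1 < x ∧ q < p.2 := by
  have hone : (1 : Cardinal.{u}) < κ := one_lt_aleph0.trans_le hκ.aleph0_le
  -- The new point is taken above the part of the domain below `x`, which is not cofinal in `x`.
  obtain ⟨y, hyx, hy⟩ := exists_forall_lt_of_le_cof hcof
    (A := Prod.fst '' {p ∈ G | p.1 < x})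
    (mk_image_le.trans_lt ((mk_le_mk_of_subset (sep_subset _ _)).trans_lt hc))
    (by rintro _ ⟨p, hp, rfl⟩; exact hp.2)
  have hy' : ∀ p ∈ G, p.1 < x → p.1 < y := fun p hp h => hy _ ⟨p, ⟨hp, h⟩, rfl⟩
  have hle : ∀ p ∈ G, y ≤ p.1 → r ≤ p.2 := fun p hp h => by
    by_contra! hlt
    exact (hy' p hp ((hG p hp _ hx).2 hlt)).not_ge h
  obtain ⟨s, hs, h1, h2⟩ := hG.exists_extension hκ hQ hc (x := y) (A := {q})
    (fun p hp h => (hy' p hp (h.trans_lt hyx)).ne h) (by simpa using hone)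
    (by rintro _ rfl p hp h; exact hq.trans_le (hle p hp h.le))
  exact ⟨_, subset_insert _ _, h1, h2, (y, s), mem_insert _ _, hyx, hs q rfl⟩

theorem IsSaturatedOrder.dual (hQ : IsSaturatedOrder κ Q) : IsSaturatedOrder κ Qᵒᵈ :=
  fun S T hS hT h => by
    obtain ⟨x, h1, h2⟩ := hQ T S hT hS fun t ht s hs => h s hs t ht
    exact ⟨x, h2, h1⟩

theorem IsPartialEmbedding.exists_approach_dual (hκ : κ.IsRegular) (hQ : IsSaturatedOrder κ Q)
    {G : Set (L × Q)} (hG : IsPartialEmbedding G) (hc : #G < κ) {x : L} {r q : Q} (hx : (x, r) ∈ G)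
    (hq : r < q) (hcof : κ ≤ Order.cof (Ioi x)ᵒᵈ) :
    ∃ G', G ⊆ G' ∧ IsPartialEmbedding G' ∧ #G' < κ ∧ ∃ p ∈ G', x < p.1 ∧ p.2 < q := by
  obtain ⟨G', h1, h2, h3⟩ := IsPartialEmbedding.exists_approach (L := Lᵒᵈ) (Q := Qᵒᵈ) hκ hQ.dual
    (G := G) (fun p hp q hq => hG q hq p hp) hc hx hq hcof
  exact ⟨G', h1, fun p hp q hq => h2 q hq p hp, h3⟩

/-- An order of size at most `κ` embeds into a saturated order of size at most `κ` so that the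
embedding is continuous from every side on which a point has character at least `κ`. -/
theorem exists_strictMono_approaching (hκ : κ.IsRegular) (hL : #L ≤ κ) (hQc : #Q ≤ κ)
    (hQ : IsSaturatedOrder κ Q) :
    ∃ g : L → Q, StrictMono g ∧
      (∀ x, κ ≤ Order.cof (Iio x) → ∀ q < g x, ∃ y < x, q < g y) ∧
      (∀ x, κ ≤ Order.cof (Ioi x)ᵒᵈ → ∀ q, g x < q → ∃ y, x < y ∧ g y < q) := by
  -- The task `(x, q)` is to define the embedding at `x` and to approach its value there beyond `q`,
  -- from the side on which `q` lies.
  obtain ⟨G, hG, hR⟩ := exists_of_small_extensions hκ (α := L × Q) (T := L × Q)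
    (by rw [mk_prod, lift_id, lift_id]; exact mul_le_of_le hκ.aleph0_le hL hQc)
    (P := IsPartialEmbedding) (R := fun t G => ∃ r, (t.1, r) ∈ G ∧
      (t.2 < r → κ ≤ Order.cof (Iio t.1) → ∃ p ∈ G, p.1 < t.1 ∧ t.2 < p.2) ∧
      (r < t.2 → κ ≤ Order.cof (Ioi t.1)ᵒᵈ → ∃ p ∈ G, t.1 < p.1 ∧ p.2 < t.2))
    (by
      rintro t G G' h ⟨r, hr, h1, h2⟩
      exact ⟨r, h hr, fun a b => (h1 a b).imp fun p hp => ⟨h hp.1, hp.2⟩,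
        fun a b => (h2 a b).imp fun p hp => ⟨h hp.1, hp.2⟩⟩)
    (fun C hC h => IsPartialEmbedding.sUnion hC h)
    (by
      rintro ⟨x, q⟩ G hG hc
      obtain ⟨G₁, r, hsub, hG₁, hc₁, hr⟩ : ∃ G₁ r, G ⊆ G₁ ∧ IsPartialEmbedding G₁ ∧ #G₁ < κ ∧
          (x, r) ∈ G₁ := by
        by_cases h : ∃ r, (x, r) ∈ G
        · exact ⟨G, h.choose, subset_rfl, hG, hc, h.choose_spec⟩
        · obtain ⟨r, -, h1, h2⟩ := hG.exists_extension hκ hQ hc (x := x) (A := ∅)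
            (by rintro ⟨y, r⟩ hp rfl; exact h ⟨r, hp⟩) (by simpa using hκ.pos) (by simp)
          exact ⟨_, r, subset_insert _ _, h1, h2, mem_insert _ _⟩
      by_cases hlo : q < r ∧ κ ≤ Order.cof (Iio x)
      · obtain ⟨G₂, h1, h2, h3, h4⟩ := hG₁.exists_approach hκ hQ hc₁ hr hlo.1 hlo.2
        exact ⟨G₂, hsub.trans h1, h2, h3, r, h1 hr, fun _ _ => h4, fun h => absurd h hlo.1.not_gt⟩
      by_cases hhi : r < q ∧ κ ≤ Order.cof (Ioi x)ᵒᵈ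
      · obtain ⟨G₂, h1, h2, h3, h4⟩ := hG₁.exists_approach_dual hκ hQ hc₁ hr hhi.1 hhi.2
        exact ⟨G₂, hsub.trans h1, h2, h3, r, h1 hr, fun h => absurd h hhi.1.not_gt, fun _ _ => h4⟩
      exact ⟨G₁, hsub, hG₁, hc₁, r, hr, fun a b => absurd ⟨a, b⟩ hlo,
        fun a b => absurd ⟨a, b⟩ hhi⟩)
  have hval : ∀ {x r r'}, (x, r) ∈ G → (x, r') ∈ G → r = r' := fun h h' =>
    le_antisymm (not_lt.1 fun hlt => lt_irrefl _ ((hG _ h' _ h).2 hlt))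
      (not_lt.1 fun hlt => lt_irrefl _ ((hG _ h _ h').2 hlt))
  have hQne : Nonempty Q := by
    obtain ⟨x, -⟩ := hQ ∅ ∅ (by simpa using hκ.pos) (by simpa using hκ.pos) (by simp)
    exact ⟨x⟩
  have hex : ∀ x, ∃ r, (x, r) ∈ G := fun x => by
    obtain ⟨r, hr, -⟩ := hR (x, hQne.some)
    exact ⟨r, hr⟩
  choose g hg using hex
  refine ⟨g, fun x y h => (hG _ (hg x) _ (hg y)).1 h, fun x hx q hq => ?_, fun x hx q hq => ?_⟩
  · obtain ⟨r, hr, h, -⟩ := hR (x, q)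
    obtain ⟨⟨y, s⟩, hp, hyx, hqs⟩ := h (by rwa [hval hr (hg x)]) hx
    exact ⟨y, hyx, by rwa [hval (hg y) hp]⟩
  · obtain ⟨r, hr, -, h⟩ := hR (x, q)
    obtain ⟨⟨y, s⟩, hp, hyx, hqs⟩ := h (by rwa [hval hr (hg x)]) hx
    exact ⟨y, hyx, by rwa [hval (hg y) hp]⟩

end PartialEmbedding

/-! ### Continuity of monotone maps -/

section Continuity

variable {A B : Type u} [LinearOrder A] [LinearOrder B]

/-- A monotone map that is continuous from the left and from the right at every limit point is
continuous for the order topologies. -/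
theorem Monotone.continuous_of_approach {f : A → B} (hf : Monotone f)
    (hl : ∀ x, (Iio x).Nonempty → IsLUB (Iio x) x → ∀ c < f x, ∃ z < x, ∀ w, z < w → c < f w)
    (hr : ∀ x, (Ioi x).Nonempty → IsGLB (Ioi x) x → ∀ c, f x < c → ∃ z, x < z ∧ ∀ w < z, f w < c) :
    @Continuous A B (Preorder.topology A) (Preorder.topology B) f := by
  let _ : TopologicalSpace A := Preorder.topology A
  have : OrderTopology A := ⟨rfl⟩
  refine continuous_generateFrom_iff.2 ?_
  rintro _ ⟨c, rfl | rfl⟩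
  · refine isOpen_iff_mem_nhds.2 fun x hx => ?_
    by_cases hne : (Iio x).Nonempty
    · by_cases hlim : IsLUB (Iio x) x
      · obtain ⟨z, hz, h⟩ := hl x hne hlim c hx
        exact Filter.mem_of_superset (Ioi_mem_nhds hz) fun w hw => h w hw
      · obtain ⟨b, hb, hbx⟩ : ∃ b ∈ upperBounds (Iio x), b < x := by
          by_contra! h
          exact hlim ⟨fun y hy => le_of_lt hy, h⟩
        refine Filter.mem_of_superset (Ioi_mem_nhds hbx) fun w hw => ?_
        exact lt_of_lt_of_le hx (hf (not_lt.1 fun h => (hb h).not_gt hw))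
    · refine Filter.mem_of_superset Filter.univ_mem fun w _ => ?_
      exact lt_of_lt_of_le hx (hf (not_lt.1 fun h => hne ⟨w, h⟩))
  · refine isOpen_iff_mem_nhds.2 fun x hx => ?_
    by_cases hne : (Ioi x).Nonempty
    · by_cases hlim : IsGLB (Ioi x) x
      · obtain ⟨z, hz, h⟩ := hr x hne hlim c hx
        exact Filter.mem_of_superset (Iio_mem_nhds hz) fun w hw => h w hw
      · obtain ⟨b, hb, hbx⟩ : ∃ b ∈ lowerBounds (Ioi x), x < b := by
          by_contra! h
          exact hlim ⟨fun y hy => le_of_lt hy, h⟩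
        refine Filter.mem_of_superset (Iio_mem_nhds hbx) fun w hw => ?_
        exact lt_of_le_of_lt (hf (not_lt.1 fun h => (hb h).not_gt hw)) hx
    · refine Filter.mem_of_superset Filter.univ_mem fun w _ => ?_
      exact lt_of_le_of_lt (hf (not_lt.1 fun h => hne ⟨w, h⟩)) hx

end Continuity

/-! ### Embedding into the completion -/

section Embedding

variable {κ : Cardinal.{u}} {L Q : Type u} [LinearOrder L] [LinearOrder Q]

theorem exists_isSeqCut_sup {g : L → Q} (hg : StrictMono g) {x : L} (hne : (Iio x).Nonempty)
    (hcof : Order.cof (Iio x) < κ) :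
    ∃ c : DedekindCut Q, IsSeqCut κ c ∧
      IsLUB ((fun y => DedekindCut.principal (g y)) '' Iio x) c := by
  obtain ⟨C, hC, hCc⟩ := Order.exists_cof_eq (Iio x)
  have hCne : C.Nonempty := by
    have := hne.to_subtype
    exact hC.nonempty
  refine ⟨sSup (DedekindCut.principal '' ((fun y : Iio x => g y) '' C)), Or.inr (Or.inl
    ⟨_, hCne.image _, ⟨g x, ?_⟩, mk_image_le.trans_lt (hCc.trans_lt hcof), rfl⟩), ?_, ?_⟩
  · rintro _ ⟨y, -, rfl⟩
    exact (hg y.2).le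
  · rintro _ ⟨y, hy, rfl⟩
    obtain ⟨w, hw, hyw⟩ := hC ⟨y, hy⟩
    have h1 : DedekindCut.principal (g y) ≤ DedekindCut.principal (g w) :=
      DedekindCut.principal_le_principal.2 (hg.monotone hyw)
    exact h1.trans (le_sSup ⟨_, ⟨w, hw, rfl⟩, rfl⟩)
  · intro b hb
    refine sSup_le ?_
    rintro _ ⟨_, ⟨w, -, rfl⟩, rfl⟩
    exact hb ⟨w, w.2, rfl⟩

theorem exists_isSeqCut_inf {g : L → Q} (hg : StrictMono g) {x : L} (hne : (Ioi x).Nonempty)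
    (hcof : Order.cof (Ioi x)ᵒᵈ < κ) :
    ∃ c : DedekindCut Q, IsSeqCut κ c ∧
      IsGLB ((fun y => DedekindCut.principal (g y)) '' Ioi x) c := by
  obtain ⟨C, hC, hCc⟩ := Order.exists_cof_eq (Ioi x)ᵒᵈ
  have hCne : C.Nonempty := by
    have : Nonempty (Ioi x)ᵒᵈ := hne.to_subtype
    exact hC.nonempty
  refine ⟨sInf (DedekindCut.principal ''
      ((fun y : (Ioi x)ᵒᵈ => g (OrderDual.ofDual y : Ioi x)) '' C)),
    Or.inr (Or.inr
    ⟨_, hCne.image _, ⟨g x, ?_⟩, mk_image_le.trans_lt (hCc.trans_lt hcof), rfl⟩), ?_, ?_⟩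
  · rintro _ ⟨y, -, rfl⟩
    exact (hg (OrderDual.ofDual y : Ioi x).2).le
  · rintro _ ⟨y, hy, rfl⟩
    obtain ⟨w, hw, hyw⟩ := hC (OrderDual.toDual ⟨y, hy⟩)
    have h1 : DedekindCut.principal (g (OrderDual.ofDual w : Ioi x)) ≤
        DedekindCut.principal (g y) :=
      DedekindCut.principal_le_principal.2 (hg.monotone hyw)
    exact le_trans (sInf_le ⟨_, ⟨w, hw, rfl⟩, rfl⟩) h1
  · intro b hb
    refine le_sInf ?_
    rintro _ ⟨_, ⟨w, -, rfl⟩, rfl⟩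
    exact hb ⟨(OrderDual.ofDual w : Ioi x), (OrderDual.ofDual w : Ioi x).2, rfl⟩

/-- `c` is a suitable value at `x` for a continuous strictly monotone map into the Dedekind
completion that follows `g : L → Q`: it is weakly between the values of `g` on the two sides of `x`,
it is moved away from `g x` only towards a side from which `x` is a limit, and it is approached by
values of `g` from every side from which `x` is a limit. The nonemptiness assumptions are there
because `IsLUB (Iio x) x` holds also at a least element `x`, and dually. -/
structure IsLimitValue (g : L → Q) (x : L) (c : DedekindCut Q) : Prop where
  le_of_lt : ∀ z < x, DedekindCut.principal (g z) ≤ c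
  ge_of_gt : ∀ z, x < z → c ≤ DedekindCut.principal (g z)
  le_self : ¬ IsGLB (Ioi x) x → c ≤ DedekindCut.principal (g x)
  self_le : ¬ IsLUB (Iio x) x → DedekindCut.principal (g x) ≤ c
  left_limit : (Iio x).Nonempty → IsLUB (Iio x) x → ∀ d < c,
    ∃ z < x, d < DedekindCut.principal (g z)
  right_limit : (Ioi x).Nonempty → IsGLB (Ioi x) x → ∀ d, c < d →
    ∃ z, x < z ∧ DedekindCut.principal (g z) < d

/-- The value is the supremum of `g` on `Iio x` if `x` is a limit from the left of cofinality `< κ`,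
the infimum of `g` on `Ioi x` if `x` is a limit from the right of coinitiality `< κ`, and `g x`
otherwise. Entwinedness says that in the first two cases `x` is not a limit from the other side. -/
theorem IsEntwined.exists_isLimitValue (hL : IsEntwined κ L) {g : L → Q} (hg : StrictMono g)
    (hgl : ∀ x, κ ≤ Order.cof (Iio x) → ∀ q < g x, ∃ y < x, q < g y)
    (hgr : ∀ x, κ ≤ Order.cof (Ioi x)ᵒᵈ → ∀ q, g x < q → ∃ y, x < y ∧ g y < q) (x : L) :
    ∃ c, IsSeqCut κ c ∧ IsLimitValue g x c := by
  by_cases hl : (Iio x).Nonempty ∧ IsLUB (Iio x) x ∧ Order.cof (Iio x) < κ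
  · obtain ⟨hne, hlub, hcof⟩ := hl
    obtain ⟨c, hc, h⟩ := exists_isSeqCut_sup hg hne hcof
    have hle : c ≤ DedekindCut.principal (g x) := h.2 (by
      rintro _ ⟨y, hy, rfl⟩
      exact DedekindCut.principal_le_principal.2 (hg hy).le)
    refine ⟨c, hc, fun z hz => h.1 ⟨z, hz, rfl⟩, fun z hz =>
      hle.trans (DedekindCut.principal_le_principal.2 (hg hz).le), fun _ => hle,
      fun h' => absurd hlub h', fun _ _ d hd => ?_, fun hne' hglb => ?_⟩
    · obtain ⟨_, ⟨z, hz, rfl⟩, h', -⟩ := h.exists_between hd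
      exact ⟨z, hz, h'⟩
    · exact absurd (hL.limit x hne hne' hlub hglb).1 hcof.ne
  by_cases hr : (Ioi x).Nonempty ∧ IsGLB (Ioi x) x ∧ Order.cof (Ioi x)ᵒᵈ < κ
  · obtain ⟨hne, hglb, hcof⟩ := hr
    obtain ⟨c, hc, h⟩ := exists_isSeqCut_inf hg hne hcof
    have hle : DedekindCut.principal (g x) ≤ c := h.2 (by
      rintro _ ⟨y, hy, rfl⟩
      exact DedekindCut.principal_le_principal.2 (hg hy).le)
    refine ⟨c, hc, fun z hz => (DedekindCut.principal_le_principal.2 (hg hz).le).trans hle,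
      fun z hz => h.1 ⟨z, hz, rfl⟩, fun h' => absurd hglb h',
      fun _ => hle, fun hne' hlub => ?_, fun _ _ d hd => ?_⟩
    · exact absurd (hL.limit x hne' hne hlub hglb).2 hcof.ne
    · obtain ⟨_, ⟨z, hz, rfl⟩, -, h'⟩ := h.exists_between hd
      exact ⟨z, hz, h'⟩
  refine ⟨DedekindCut.principal (g x), Or.inl ⟨_, rfl⟩,
    fun z hz => DedekindCut.principal_le_principal.2 (hg hz).le,
    fun z hz => DedekindCut.principal_le_principal.2 (hg hz).le, fun _ => le_rfl, fun _ => le_rfl,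
    fun hne hlub d hd => ?_, fun hne hglb d hd => ?_⟩
  · obtain ⟨q, hdq, hq⟩ := DedekindCut.lt_iff_exists'.1 hd
    obtain ⟨y, hy, hqy⟩ := hgl x (not_lt.1 fun h => hl ⟨hne, hlub, h⟩) q
      (DedekindCut.principal_lt_principal.1 hq)
    exact ⟨y, hy, hdq.trans_lt (DedekindCut.principal_lt_principal.2 hqy)⟩
  · obtain ⟨q, hq, hdq⟩ := DedekindCut.lt_iff_exists.1 hd
    obtain ⟨y, hy, hqy⟩ := hgr x (not_lt.1 fun h => hr ⟨hne, hglb, h⟩) q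
      (DedekindCut.principal_lt_principal.1 hq)
    exact ⟨y, hy, (DedekindCut.principal_lt_principal.2 hqy).trans_le hdq⟩

theorem IsLimitValue.lt {g : L → Q} (hg : StrictMono g) {x y : L} {c d : DedekindCut Q}
    (hc : IsLimitValue g x c) (hd : IsLimitValue g y d) (hxy : x < y) : c < d := by
  -- If `x` is a limit from the right, or `y` from the left, there are two points between them.
  have key : ∀ z w, x < z → z < w → w < y → c < d := fun z w hz hzw hw =>
    (hc.ge_of_gt z hz).trans_lt
      ((DedekindCut.principal_lt_principal.2 (hg hzw)).trans_le (hd.le_of_lt w hw))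
  by_cases h1 : IsGLB (Ioi x) x
  · obtain ⟨w, hw, -, hwy⟩ := h1.exists_between hxy
    obtain ⟨z, hz, -, hzw⟩ := h1.exists_between hw
    exact key z w hz hzw hwy
  by_cases h2 : IsLUB (Iio y) y
  · obtain ⟨z, hz, hxz, -⟩ := h2.exists_between hxy
    obtain ⟨w, hw, hzw, -⟩ := h2.exists_between hz
    exact key z w hxz hzw hw
  exact (hc.le_self h1).trans_lt
    ((DedekindCut.principal_lt_principal.2 (hg hxy)).trans_le (hd.self_le h2))

theorem IsEntwined.lotsEmbeds (hκ : κ.IsRegular) (hQ : IsRationalOrder κ Q) (hL : IsEntwined κ L) :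
    LOTSEmbeds L (SeqCompletion κ Q) := by
  obtain ⟨g, hg, hgl, hgr⟩ :=
    exists_strictMono_approaching hκ hL.card_eq.le hQ.card_eq.le hQ.saturated
  choose f hf hval using hL.exists_isLimitValue hg hgl hgr
  have hmono : StrictMono fun x => (⟨f x, hf x⟩ : SeqCompletion κ Q) :=
    fun x y h => (hval x).lt hg (hval y) h
  refine ⟨_, hmono, hmono.monotone.continuous_of_approach
    (fun x hne hlub c hc => ?_) (fun x hne hglb c hc => ?_)⟩
  · obtain ⟨z, hz, h⟩ := (hval x).left_limit hne hlub c.1 hc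
    exact ⟨z, hz, fun w hw => show c.1 < f w from h.trans_le ((hval w).le_of_lt z hw)⟩
  · obtain ⟨z, hz, h⟩ := (hval x).right_limit hne hglb c.1 hc
    exact ⟨z, hz, fun w hw => show f w < c.1 from ((hval w).ge_of_gt z hw).trans_lt h⟩

end Embedding

theorem mainTheorem6 (gch : GCH.{u}) (κ : Cardinal.{u}) (hκ : κ.IsRegular) :
    (∃ (Q : Type u) (_ : LinearOrder Q), IsRationalOrder κ Q) ∧
    ∀ (Q : Type u) [LinearOrder Q], IsRationalOrder κ Q →
      #(SeqCompletion κ Q) = κ ∧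
      ∀ (L : Type u) [LinearOrder L], IsEntwined κ L → LOTSEmbeds L (SeqCompletion κ Q) :=
  ⟨gch.exists_isRationalOrder hκ, fun _ _ hQ =>
    ⟨gch.mk_seqCompletion hκ hQ.card_eq, fun _ _ hL => hL.lotsEmbeds hκ hQ⟩⟩
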